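/- A topological dynamical system $(X,T)$ is a compact metric space $X$ with a continuous surjective map $T:X\to X$. For $x\in X$ and $U,V\subset X$ write $\mathrm{orb}(x,T)=\{T^nx:n\ge 0\}$, $N_T(x,U)=\{n\in\mathbb Z_+:T^nx\in U\}$ and $N_T(U,V)=\{n\in\mathbb Z_+:U\cap T^{-n}V\ne\emptyset\}$. The system $(X,T)$ is transitive if $N_T(U,V)$ is infinite for all nonempty open $U,V\subset X$; weakly mixing if $(X\times X,T\times T)$ is transitive; minimal if $X\neq\emptyset$ and every point has a dense orbit. A point $x\in X$ is minimal if the subsystem $(\overline{\mathrm{orb}(x,T)},T)$ is minimal. A set $A\subset\mathbb Z_+$ is syndetic if there is $N$ such that $\{i,i+1,\dots,i+N\}\cap A\ne\emptyset$ for every $i\in\mathbb Z_+$. A joining of $(X,T)$ and $(Y,S)$ is a nonempty closed set $J\subset X\times Y$ with $(T\times S)J\subset J$ which is mapped onto $X$ and onto $Y$ by the coordinate projections; $(X,T)$ and $(Y,S)$ are disjoint if $X\times Y$ is the only joining. **Theorem.** Let $(X,T)$ be a transitive topological dynamical system. The following statements are equivalent. 1. $(X,T)$ is disjoint from all minimal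 systems. 2. $(X,T)$ is weakly mixing, and for every minimal system $(Y,S)$, every nonempty open $U\subset X$ and every nonempty open $V\subset Y$ there is a point $x=x(U,V)\in U$ such that $N_{T\times S}((x,y),U\times V)$ is syndetic for every $y\in V$. 3. $(X,T)$ is weakly mixing, and for every minimal system $(Y,S)$, every nonempty open $U\subset X$ and every nonempty open $V\subset Y$ there is a minimal point $x=x(U,V)\in U$ such that $N_{T\times S}((x,y),U\times V)$ is syndetic for every $y\in V$. -/

import Mathlib

universe u v

namespace TopDyn

/-- The pair `(X, T)` is a topological dynamical system: `T` is continuous and surjective.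
(The phase space `X` is a compact metric space; this is carried by the instances.) -/
structure IsTDS {X : Type u} [TopologicalSpace X] (T : X → X) : Prop where
  continuous : Continuous T
  surjective : Function.Surjective T

/-- The forward orbit `{T ^ n x : n ≥ 0}`. -/
def orb {X : Type u} (T : X → X) (x : X) : Set X :=
  Set.range fun n : ℕ => T^[n] x

/-- `N_T(x, U) = {n ≥ 0 : T ^ n x ∈ U}`. -/
def hitTimes {X : Type u} (T : X → X) (x : X) (U : Set X) : Set ℕ :=
  {n | T^[n] x ∈ U}

/-- `N_T(U, V) = {n ≥ 0 : U ∩ T ^ (-n) V ≠ ∅}`. -/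
def meetTimes {X : Type u} (T : X → X) (U V : Set X) : Set ℕ :=
  {n | (U ∩ T^[n] ⁻¹' V).Nonempty}

/-- Topological transitivity: `N_T(U, V)` is infinite for all nonempty open `U`, `V`. -/
def IsTransitive {X : Type u} [TopologicalSpace X] (T : X → X) : Prop :=
  ∀ U V : Set X, IsOpen U → U.Nonempty → IsOpen V → V.Nonempty → (meetTimes T U V).Infinite

/-- Weak mixing: the product system `(X × X, T × T)` is transitive. -/
def IsWeaklyMixing {X : Type u} [TopologicalSpace X] (T : X → X) : Prop :=
  IsTransitive (Prod.map T T)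

/-- Minimality: the space is nonempty and every point has a dense forward orbit. -/
def IsMinimalSystem {X : Type u} [TopologicalSpace X] (T : X → X) : Prop :=
  Nonempty X ∧ ∀ x : X, Dense (orb T x)

/-- A minimal (almost periodic) point: its orbit closure is a minimal subsystem, that is, every
point of the orbit closure has an orbit which is dense in it. -/
def IsMinimalPoint {X : Type u} [TopologicalSpace X] (T : X → X) (x : X) : Prop :=
  ∀ z ∈ closure (orb T x), closure (orb T z) = closure (orb T x)

/-- A set of nonnegative integers is syndetic if it has bounded gaps. -/
def IsSyndetic (A : Set ℕ) : Prop :=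
  ∃ N : ℕ, ∀ i : ℕ, (Set.Icc i (i + N) ∩ A).Nonempty

/-- A joining of `(X, T)` and `(Y, S)`: a nonempty closed invariant subset of `X × Y` which is
mapped onto `X` and onto `Y` by the coordinate projections. -/
structure IsJoining {X : Type u} {Y : Type v} [TopologicalSpace X] [TopologicalSpace Y]
    (T : X → X) (S : Y → Y) (J : Set (X × Y)) : Prop where
  nonempty : J.Nonempty
  isClosed : IsClosed J
  invariant : Set.MapsTo (Prod.map T S) J J
  image_fst : Prod.fst '' J = Set.univ
  image_snd : Prod.snd '' J = Set.univ

/-- Disjointness of two systems: the full product `X × Y` is the only joining. -/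
def AreDisjoint {X : Type u} {Y : Type v} [TopologicalSpace X] [TopologicalSpace Y]
    (T : X → X) (S : Y → Y) : Prop :=
  ∀ J : Set (X × Y), IsJoining T S J → J = Set.univ

/-- Disjointness from all minimal systems on compact metric spaces. Every compact metric space is
homeomorphic to one in any given universe, so one universe is enough. -/
def DisjointFromMinimal {X : Type u} [TopologicalSpace X] (T : X → X) : Prop :=
  ∀ (Y : Type u) [MetricSpace Y] [CompactSpace Y] (S : Y → Y),
    IsTDS S → IsMinimalSystem S → AreDisjoint T S

end TopDyn

/-! Disjointness from a minimal system is used through one consequence: a point with dense orbit and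
a point of the minimal system visit prescribed nonempty open sets simultaneously, because their
joint orbit closure is a joining (`DisjointFromMinimal.exists_iterate_mem`).

From 1 to 3, minimal points are dense. Otherwise a transitive point avoids some closed neighbourhood
along a thickly syndetic set of times; such a set supports a nonzero uniformly recurrent 0-1
sequence, whose orbit closure under the shift is a minimal system contradicting disjointness. Weak
mixing follows by pairing a transitive point with a minimal point. For the syndetic condition,
compactness bounds by some `K` the joint visiting time of a transitive point `x₀ ∈ U` with any `y`;
a minimal point close to `x₀` copies its visits up to time `K` and returns syndetically to where it
does so.

From 3 to 2 nothing is needed. From 2 to 1, weak mixing makes proximal cells dense, so by Baire a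
joining `J` contains a pair `(u, S^i y)` with `u` proximal to `T^i x` and `y ∈ V`. Syndetic visits
of `(x, y)` to `U × V` then force `J` to meet `closure U × closure V`
(`exists_mem_joining_closure`). -/

namespace TopDyn

/-! ### Uniformly recurrent 0-1 sequences supported in a thickly syndetic set. -/

section Words

/-- The word `w`, placed at position `a`, has all its letters `true` at places in `C`. -/
def SupportedAt (C : Set ℕ) (a : ℕ) (w : List Bool) : Prop :=
  ∀ i, w[i]? = some true → a + i ∈ C

theorem SupportedAt.append {C : Set ℕ} {a : ℕ} {v w : List Bool} (hv : SupportedAt C a v)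
    (hw : SupportedAt C (a + v.length) w) : SupportedAt C a (v ++ w) := by
  intro i hi
  rcases lt_or_ge i v.length with h | h
  · rw [List.getElem?_append_left h] at hi
    exact hv i hi
  · rw [List.getElem?_append_right h] at hi
    have := hw _ hi
    rwa [show a + v.length + (i - v.length) = a + i by omega] at this

/-- A set of integers is thickly syndetic if it contains intervals of every length, with bounded
gaps between them. -/
def IsThicklySyndetic (C : Set ℕ) : Prop :=
  ∀ L : ℕ, ∃ g : ℕ, ∀ n : ℕ, ∃ m, n ≤ m ∧ m ≤ n + g ∧ ∀ i < L, m + i ∈ C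

/-- The concatenations of words from `L`. -/
def concats (L : Set (List Bool)) : Set (List Bool) :=
  {s | ∃ ls : List (List Bool), (∀ l ∈ ls, l ∈ L) ∧ ls.flatten = s}

theorem nil_mem_concats (L : Set (List Bool)) : [] ∈ concats L :=
  ⟨[], by simp, rfl⟩

theorem subset_concats (L : Set (List Bool)) : L ⊆ concats L :=
  fun l hl => ⟨[l], by simpa using hl, by simp⟩

theorem append_mem_concats {L : Set (List Bool)} {v w : List Bool} (hv : v ∈ concats L)
    (hw : w ∈ concats L) : v ++ w ∈ concats L := by
  obtain ⟨ls, hls, rfl⟩ := hv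
  obtain ⟨ms, hms, rfl⟩ := hw
  refine ⟨ls ++ ms, ?_, by simp⟩
  intro l hl
  rcases List.mem_append.1 hl with h | h
  · exact hls l h
  · exact hms l h

/-- Position `i` falls inside some block, and the following block contains a full copy of `p`. The
margin `2 * B` guarantees that this following block exists. -/
theorem exists_prefix_drop_of_mem_concats {L : Set (List Bool)} {p : List Bool} {B : ℕ}
    (hB : 0 < B) (hL : ∀ l ∈ L, l.length ≤ B ∧ p <:+: l) {s : List Bool} (hs : s ∈ concats L)
    {i : ℕ} (hi : i + 2 * B ≤ s.length) : ∃ j, i ≤ j ∧ j ≤ i + 2 * B ∧ p <+: s.drop j := by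
  obtain ⟨ls, hls, rfl⟩ := hs
  induction ls generalizing i with
  | nil => simp at hi; omega
  | cons l ls ih =>
    rw [List.flatten_cons, List.length_append] at hi
    have hl := (hL l (hls l (by simp))).1
    rcases le_or_gt l.length i with h | h
    · obtain ⟨j, h1, h2, h3⟩ := ih (fun m hm => hls m (by simp [hm])) (i := i - l.length)
        (by omega)
      refine ⟨l.length + j, by omega, by omega, ?_⟩
      rwa [List.flatten_cons, List.drop_length_add_append]
    · cases ls with
      | nil => simp at hi; omega
      | cons l' ls =>
        obtain ⟨hl', a, b, rfl⟩ := hL l' (hls l' (by simp))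
        simp only [List.length_append] at hl'
        refine ⟨l.length + a.length, by omega, by omega, b ++ ls.flatten, ?_⟩
        simp [List.drop_append]

/-- A stage in the construction of a uniformly recurrent sequence supported in `C`: a finite word
supported in `C`, and a set of words, closed under concatenation, which is rich enough to continue
the construction. -/
structure BlockStage (C : Set ℕ) where
  words : Set (List Bool)
  word : List Bool
  nil_mem : [] ∈ words
  append_mem : ∀ v ∈ words, ∀ w ∈ words, v ++ w ∈ words
  word_mem : word ∈ words
  word_ne_nil : word ≠ []
  supportedAt : SupportedAt C 0 word
  exists_fill : ∃ M, ∀ a n, M ≤ n → ∃ w ∈ words, w.length = n ∧ SupportedAt C a w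

theorem BlockStage.concats_subset {C : Set ℕ} (σ : BlockStage C) {L : Set (List Bool)}
    (hL : L ⊆ σ.words) : concats L ⊆ σ.words := by
  rintro _ ⟨ls, hls, rfl⟩
  induction ls with
  | nil => exact σ.nil_mem
  | cons l ls ih =>
    rw [List.flatten_cons]
    exact σ.append_mem _ (hL (hls l (by simp))) _ (ih fun m hm => hls m (by simp [hm]))

/-- The new language is generated by words of bounded length that each contain the current word,
which therefore recurs with bounded gaps in everything built later. Its copies are placed on
intervals contained in `C`, with fillers from `exists_fill` around them. -/
theorem BlockStage.exists_next {C : Set ℕ} (hC : IsThicklySyndetic C) (σ : BlockStage C) :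
    ∃ τ : BlockStage C, τ.words ⊆ σ.words ∧
      (∃ v ∈ τ.words, v ≠ [] ∧ τ.word = σ.word ++ v) ∧
      ∃ B, ∀ s ∈ τ.words, ∀ i, i + B ≤ s.length →
        ∃ j, i ≤ j ∧ j ≤ i + B ∧ σ.word <+: s.drop j := by
  obtain ⟨M, hM⟩ := σ.exists_fill
  obtain ⟨g, hg⟩ := hC σ.word.length
  have hp : 0 < σ.word.length := List.length_pos_iff.2 σ.word_ne_nil
  -- The left filler has length between `M` and `M + g`; total length at least `M'` leaves at least
  -- `M` for the right filler.
  set M' := 2 * M + g + σ.word.length with hM'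
  set L : Set (List Bool) :=
    {l | l.length ≤ 2 * M' ∧ ∃ a ∈ σ.words, ∃ b ∈ σ.words, l = a ++ (σ.word ++ b)} with hL
  have hLσ : L ⊆ σ.words := by
    rintro _ ⟨-, a, ha, b, hb, rfl⟩
    exact σ.append_mem _ ha _ (σ.append_mem _ σ.word_mem _ hb)
  have hsingle : ∀ a n, M' ≤ n → n ≤ 2 * M' → ∃ w ∈ L, w.length = n ∧ SupportedAt C a w := by
    intro a n h1 h2
    obtain ⟨m, hm1, hm2, hm⟩ := hg (a + M)
    obtain ⟨v, hv, hvl, hvs⟩ := hM a (m - a) (by omega)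
    obtain ⟨w, hw, hwl, hws⟩ := hM (m + σ.word.length) (n - (m - a) - σ.word.length) (by omega)
    have hlen : (v ++ (σ.word ++ w)).length = n := by
      simp only [List.length_append]
      omega
    refine ⟨v ++ (σ.word ++ w), ⟨by omega, v, hv, w, hw, rfl⟩, hlen, hvs.append ?_⟩
    rw [hvl, show a + (m - a) = m by omega]
    refine SupportedAt.append (fun i hi => hm i ?_) hws
    exact (List.getElem?_eq_some_iff.1 hi).1
  -- Realising every length in `[M', 2M']` suffices: beyond `2M'`, cutting off a block of length
  -- `M'` leaves a remainder longer than `M'`.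
  have hfill : ∀ n a, M' ≤ n → ∃ w ∈ concats L, w.length = n ∧ SupportedAt C a w := by
    intro n
    induction n using Nat.strong_induction_on with
    | _ n ih =>
      intro a hn
      rcases le_or_gt n (2 * M') with h | h
      · obtain ⟨w, hw, h'⟩ := hsingle a n hn h
        exact ⟨w, subset_concats L hw, h'⟩
      · obtain ⟨v, hv, hvl, hvs⟩ := hsingle a M' le_rfl (by omega)
        obtain ⟨w, hw, hwl, hws⟩ := ih (n - M') (by omega) (a + M') (by omega)
        refine ⟨v ++ w, append_mem_concats (subset_concats L hv) hw, ?_, hvs.append ?_⟩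
        · rw [List.length_append]
          omega
        · rwa [hvl]
  obtain ⟨v, hv, hvl, hvs⟩ := hfill M' σ.word.length le_rfl
  refine ⟨⟨concats L, σ.word ++ v, nil_mem_concats L, fun _ h _ h' => append_mem_concats h h',
    append_mem_concats (subset_concats L ⟨by omega, [], σ.nil_mem, [], σ.nil_mem, by simp⟩) hv,
    by simp [σ.word_ne_nil], σ.supportedAt.append (by rwa [zero_add]),
    M', fun a n h => hfill n a h⟩, σ.concats_subset hLσ, ⟨v, hv, ?_, rfl⟩, 2 * (2 * M'), ?_⟩
  · rintro rfl
    simp at hvl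
    omega
  · intro s hs i hi
    refine exists_prefix_drop_of_mem_concats (by omega) ?_ hs hi
    rintro _ ⟨hl, a, -, b, -, rfl⟩
    exact ⟨hl, a, b, by simp⟩

theorem exists_blockStage {C : Set ℕ} (hC : C.Nonempty) :
    ∃ σ : BlockStage C, true ∈ σ.word := by
  obtain ⟨n, hn⟩ := hC
  refine ⟨⟨Set.univ, List.replicate n false ++ [true], trivial, fun _ _ _ _ => trivial, trivial,
    by simp, SupportedAt.append ?_ ?_, 0, fun a m _ => ⟨List.replicate m false, trivial,
      by simp, ?_⟩⟩, by simp⟩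
  · intro i hi
    simp [List.getElem?_replicate] at hi
  · intro i hi
    rcases i with - | i
    · simpa using hn
    · simp at hi
  · intro i hi
    simp [List.getElem?_replicate] at hi

/-- A thickly syndetic set contains the support of a nonzero uniformly recurrent sequence. -/
theorem IsThicklySyndetic.exists_uniformlyRecurrent {C : Set ℕ} (hC : IsThicklySyndetic C) :
    ∃ y : ℕ → Bool, (∀ n, y n = true → n ∈ C) ∧ (∃ n, y n = true) ∧
      ∀ N, IsSyndetic {j | ∀ i < N, y (j + i) = y i} := by
  have hne : C.Nonempty := by
    obtain ⟨g, hg⟩ := hC 1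
    obtain ⟨m, -, -, hm⟩ := hg 0
    exact ⟨_, hm 0 one_pos⟩
  obtain ⟨σ₀, hσ₀⟩ := exists_blockStage hne
  choose next hsub hword hret using BlockStage.exists_next hC
  let σ : ℕ → BlockStage C := fun k => next^[k] σ₀
  have hσ : ∀ k, σ (k + 1) = next (σ k) := fun k => Function.iterate_succ_apply' next k σ₀
  have hanti : Antitone fun k => (σ k).words :=
    antitone_nat_of_succ_le fun k => by
      rw [hσ]
      exact hsub (σ k)
  -- Whatever follows the `k`-th word lies in the language of stage `k + 1`, in which that word
  -- recurs with bounded gaps.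
  have hext : ∀ k d, ∃ s ∈ (σ (k + 1)).words, (σ (k + d)).word = (σ k).word ++ s := by
    intro k d
    induction d with
    | zero => exact ⟨[], (σ (k + 1)).nil_mem, by simp⟩
    | succ d ih =>
      obtain ⟨s, hs, hs'⟩ := ih
      obtain ⟨v, hv, -, hv'⟩ := hword (σ (k + d))
      rw [← hσ] at hv hv'
      refine ⟨s ++ v, (σ (k + 1)).append_mem _ hs _ (hanti (by omega) hv), ?_⟩
      rw [← add_assoc, hv', hs', List.append_assoc]
  have hlen : ∀ k, k < (σ k).word.length := by
    intro k
    induction k with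
    | zero => exact List.length_pos_iff.2 (σ 0).word_ne_nil
    | succ k ih =>
      obtain ⟨v, -, hv, hv'⟩ := hword (σ k)
      rw [hσ, hv', List.length_append]
      have := List.length_pos_iff.2 hv
      omega
  have hpre : ∀ k l, k ≤ l → (σ k).word <+: (σ l).word := by
    intro k l h
    obtain ⟨d, rfl⟩ := Nat.exists_eq_add_of_le h
    obtain ⟨s, -, hs⟩ := hext k d
    exact ⟨s, hs.symm⟩
  have hget : ∀ k l n, n < (σ k).word.length → n < (σ l).word.length →
      (σ k).word[n]? = (σ l).word[n]? := by
    intro k l n hk hl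
    rcases le_total k l with h | h
    · obtain ⟨t, ht⟩ := hpre k l h
      rw [← ht, List.getElem?_append_left hk]
    · obtain ⟨t, ht⟩ := hpre l k h
      rw [← ht, List.getElem?_append_left hl]
  let y : ℕ → Bool := fun n => (σ n).word[n]'(hlen n)
  have hy : ∀ k n, n < (σ k).word.length → (σ k).word[n]? = some (y n) := by
    intro k n hn
    rw [hget k n n hn (hlen n)]
    exact List.getElem?_eq_getElem (hlen n)
  refine ⟨y, fun n hn => ?_, ?_, fun N => ?_⟩
  · have := (σ n).supportedAt n (by rw [hy n n (hlen n), hn])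
    rwa [zero_add] at this
  · obtain ⟨n, hn, h⟩ := List.getElem_of_mem hσ₀
    refine ⟨n, ?_⟩
    have := hy 0 n hn
    change σ₀.word[n]? = _ at this
    rw [List.getElem?_eq_getElem hn, h] at this
    exact (Option.some_injective _ this).symm
  · obtain ⟨B, hB⟩ := hret (σ N)
    rw [← hσ] at hB
    set p := (σ N).word with hp
    -- Recurrence is known only in the tail after the first copy of `p`, hence the shift by
    -- `p.length`.
    refine ⟨p.length + B, fun i => ?_⟩
    obtain ⟨s, hs, hs'⟩ := hext N (p.length + i + B)
    have hl := hlen (N + (p.length + i + B))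
    rw [hs', List.length_append, ← hp] at hl
    obtain ⟨j, hj1, hj2, hj⟩ := hB s hs i (by omega)
    refine ⟨p.length + j, ⟨by omega, by omega⟩, fun n hn => ?_⟩
    have hn' : n < p.length := hn.trans (hlen N)
    have h1 : s[j + n]? = some (y n) := by
      rw [← List.getElem?_drop, ← hy N n hn']
      obtain ⟨t, ht⟩ := hj
      rw [← ht, List.getElem?_append_left hn']
    have h2 : (p ++ s)[p.length + j + n]? = some (y n) := by
      rw [List.getElem?_append_right (by omega), ← h1]
      congr 1
      omega
    rw [← hp] at hs'
    rw [← hs', hy _ _ (by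
      rw [hs', List.length_append]
      have := (List.getElem?_eq_some_iff.1 h1).1
      omega)] at h2
    exact Option.some_injective _ h2

end Words

open Set Topology

/-! ### Minimal points, recurrence and transitive points. -/

section Orbits

variable {X : Type u} {T : X → X}

theorem iterate_mem_orb (T : X → X) (x : X) (n : ℕ) : T^[n] x ∈ orb T x :=
  ⟨n, rfl⟩

theorem orb_subset {F : Set X} (hF : MapsTo T F F) {x : X} (hx : x ∈ F) : orb T x ⊆ F := by
  rintro _ ⟨n, rfl⟩
  exact hF.iterate n hx

variable [TopologicalSpace X]

theorem mapsTo_closure_orb (hT : Continuous T) (x : X) :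
    MapsTo T (closure (orb T x)) (closure (orb T x)) := by
  refine MapsTo.closure ?_ hT
  rintro _ ⟨n, rfl⟩
  exact ⟨n + 1, Function.iterate_succ_apply' T n x⟩

theorem self_mem_closure_orb (T : X → X) (x : X) : x ∈ closure (orb T x) :=
  subset_closure (iterate_mem_orb T x 0)

theorem closure_orb_subset (hT : Continuous T) {x z : X} (hz : z ∈ closure (orb T x)) :
    closure (orb T z) ⊆ closure (orb T x) :=
  closure_minimal (orb_subset (mapsTo_closure_orb hT x) hz) isClosed_closure

theorem IsMinimalPoint.of_mem_closure_orb {z w : X} (hz : IsMinimalPoint T z)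
    (hw : w ∈ closure (orb T z)) : IsMinimalPoint T w := by
  intro w' hw'
  rw [hz w hw] at hw' ⊢
  exact hz w' hw'

theorem exists_iterate_mem_of_mem_closure_orb {x z : X} (hz : z ∈ closure (orb T x)) {U : Set X}
    (hU : IsOpen U) (hzU : z ∈ U) : ∃ n, T^[n] x ∈ U := by
  obtain ⟨_, h, n, rfl⟩ := mem_closure_iff.1 hz U hU hzU
  exact ⟨n, h⟩

/-- Every orbit closure in a compact system contains a minimal point. -/
theorem exists_isMinimalPoint [CompactSpace X] (hT : Continuous T) (x : X) :
    ∃ z ∈ closure (orb T x), IsMinimalPoint T z := by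
  obtain ⟨M, hMx, hM⟩ := zorn_superset_nonempty
    {F : Set X | IsClosed F ∧ F.Nonempty ∧ MapsTo T F F} (by
      intro c hc hchain hne
      refine ⟨⋂₀ c, ⟨isClosed_sInter fun F hF => (hc hF).1, ?_, ?_⟩,
        fun F hF => sInter_subset_of_mem hF⟩
      · have := hne.to_subtype
        exact IsCompact.nonempty_sInter_of_directed_nonempty_isCompact_isClosed
          (IsChain.directedOn hchain.symm) (fun F hF => (hc hF).2.1)
          (fun F hF => (hc hF).1.isCompact) (fun F hF => (hc hF).1)
      · exact fun z hz F hF => (hc hF).2.2 (hz F hF))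
    (closure (orb T x))
    ⟨isClosed_closure, ⟨x, self_mem_closure_orb T x⟩, mapsTo_closure_orb hT x⟩
  have key : ∀ z ∈ M, closure (orb T z) = M := by
    intro z hz
    have hsub : closure (orb T z) ⊆ M := closure_minimal (orb_subset hM.prop.2.2 hz) hM.prop.1
    exact hsub.antisymm (hM.le_of_le
      ⟨isClosed_closure, ⟨z, self_mem_closure_orb T z⟩, mapsTo_closure_orb hT z⟩ hsub)
  obtain ⟨z, hz⟩ := hM.prop.2.1
  refine ⟨z, hMx hz, fun w hw => ?_⟩
  rw [key z hz] at hw ⊢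
  exact key w hw

/-- In a compact space, a countable open cover has a finite initial segment that covers. -/
theorem exists_bound_of_iUnion_eq_univ [CompactSpace X] {G : ℕ → Set X} (hG : ∀ n, IsOpen (G n))
    (hcov : ∀ x, ∃ n, x ∈ G n) : ∃ N, ∀ x, ∃ n ≤ N, x ∈ G n := by
  obtain ⟨t, ht⟩ := isCompact_univ.elim_finite_subcover G hG
    (fun x _ => mem_iUnion.2 (hcov x))
  refine ⟨t.sup id, fun x => ?_⟩
  obtain ⟨n, hn, hx⟩ := mem_iUnion₂.1 (ht (mem_univ x))
  exact ⟨n, Finset.le_sup (f := id) hn, hx⟩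

/-- Every point of the orbit closure of `x` visits `U`; compactness bounds the waiting time. Adding
the complement of the orbit closure makes the preimages of `U` cover the whole space. -/
theorem IsMinimalPoint.isSyndetic_hitTimes [CompactSpace X] (hT : Continuous T) {x : X}
    (hx : IsMinimalPoint T x) {U : Set X} (hU : IsOpen U) (hxU : x ∈ U) :
    IsSyndetic (hitTimes T x U) := by
  obtain ⟨N, hN⟩ := exists_bound_of_iUnion_eq_univ
    (G := fun n => T^[n] ⁻¹' U ∪ (closure (orb T x))ᶜ)
    (fun n => (hU.preimage (hT.iterate n)).union isClosed_closure.isOpen_compl) (by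
      intro w
      by_cases hw : w ∈ closure (orb T x)
      · obtain ⟨n, hn⟩ := exists_iterate_mem_of_mem_closure_orb (T := T) (x := w) (z := x)
          (by rw [hx w hw]; exact self_mem_closure_orb T x) hU hxU
        exact ⟨n, Or.inl hn⟩
      · exact ⟨0, Or.inr hw⟩)
  refine ⟨N, fun i => ?_⟩
  obtain ⟨n, hn, h⟩ := hN (T^[i] x)
  rcases h with h | h
  · refine ⟨n + i, ⟨by omega, by omega⟩, ?_⟩
    rwa [hitTimes, mem_ofPred_eq, Function.iterate_add_apply]
  · exact absurd (subset_closure (iterate_mem_orb T x i)) h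

/-- A uniformly recurrent point is minimal. -/
theorem isMinimalPoint_of_isSyndetic [RegularSpace X] (hT : Continuous T) {y : X}
    (h : ∀ V ∈ 𝓝 y, IsSyndetic (hitTimes T y V)) : IsMinimalPoint T y := by
  intro w hw
  refine (closure_orb_subset hT hw).antisymm (closure_orb_subset hT ?_)
  refine mem_closure_iff_nhds.2 fun V hV => ?_
  obtain ⟨F, hF, hFc, hFV⟩ := exists_mem_nhds_isClosed_subset hV
  obtain ⟨N, hN⟩ := h F hF
  -- The orbit of `y` lies in a finite union of closed preimages of `F`, so its closure, and with it
  -- `w`, does too.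
  have hclosed : IsClosed (⋃ j ∈ Iic N, T^[j] ⁻¹' F) :=
    (finite_Iic N).isClosed_biUnion fun j _ => hFc.preimage (hT.iterate j)
  have hsub : orb T y ⊆ ⋃ j ∈ Iic N, T^[j] ⁻¹' F := by
    rintro _ ⟨n, rfl⟩
    obtain ⟨m, ⟨h1, h2⟩, hm⟩ := hN n
    refine mem_iUnion₂.2 ⟨m - n, by simp; omega, ?_⟩
    change T^[m - n] (T^[n] y) ∈ F
    rwa [← Function.iterate_add_apply, Nat.sub_add_cancel h1]
  obtain ⟨j, -, hj⟩ := mem_iUnion₂.1 (closure_minimal hsub hclosed hw)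
  exact ⟨T^[j] w, hFV hj, iterate_mem_orb T w j⟩

theorem IsMinimalSystem.exists_iterate_mem (hT : IsMinimalSystem T) {V : Set X} (hV : IsOpen V)
    (hne : V.Nonempty) (x : X) : ∃ n, T^[n] x ∈ V := by
  obtain ⟨_, h, n, rfl⟩ := (hT.2 x).inter_open_nonempty V hV hne
  exact ⟨n, h⟩

theorem IsMinimalSystem.surjective [CompactSpace X] [T2Space X] (hT : IsMinimalSystem T)
    (hc : Continuous T) : Function.Surjective T := by
  obtain ⟨x⟩ := hT.1
  rw [← range_eq_univ, ← (isCompact_range hc).isClosed.closure_eq]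
  refine Dense.closure_eq ((hT.2 (T x)).mono ?_)
  rintro _ ⟨n, rfl⟩
  exact ⟨T^[n] x, (Function.iterate_succ_apply' T n x).symm.trans (Function.iterate_succ_apply T n x)⟩

/-- The orbit closure of a minimal point is a minimal system. -/
theorem IsMinimalPoint.isMinimalSystem (hT : Continuous T) {x : X} (hx : IsMinimalPoint T x) :
    IsMinimalSystem ((mapsTo_closure_orb hT x).restrict T _ _) := by
  refine ⟨⟨⟨x, self_mem_closure_orb T x⟩⟩, fun w v => ?_⟩
  have him : Subtype.val '' orb ((mapsTo_closure_orb hT x).restrict T _ _) w = orb T w := by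
    unfold orb
    rw [← range_comp]
    congr 1
    ext n
    exact MapsTo.coe_iterate_restrict _ _ _
  rw [closure_subtype, him, hx w w.2]
  exact v.2

theorem IsTransitive.dense_setOf_dense_orb [SecondCountableTopology X] [BaireSpace X]
    (hT : Continuous T) (h : IsTransitive T) : Dense {x | Dense (orb T x)} := by
  have hb := TopologicalSpace.isBasis_countableBasis X
  have hd : Dense (⋂ b ∈ TopologicalSpace.countableBasis X, ⋃ n : ℕ, T^[n] ⁻¹' b) := by
    refine dense_biInter_of_isOpen
      (fun b hbm => isOpen_iUnion fun n => (hb.isOpen hbm).preimage (hT.iterate n))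
      (TopologicalSpace.countable_countableBasis X) fun b hbm => ?_
    refine dense_iff_inter_open.2 fun O hO hOne => ?_
    obtain ⟨n, x, hxO, hx⟩ := (h O b hO hOne (hb.isOpen hbm)
      (TopologicalSpace.nonempty_of_mem_countableBasis hbm)).nonempty
    exact ⟨x, hxO, mem_iUnion.2 ⟨n, hx⟩⟩
  refine hd.mono fun x hx => hb.dense_iff.2 fun b hbm _ => ?_
  obtain ⟨n, hn⟩ := mem_iUnion.1 (mem_iInter₂.1 hx b hbm)
  exact ⟨T^[n] x, hn, iterate_mem_orb T x n⟩

/-- If all minimal points lie in the open set `O`, then all sets of visits to `O` are thickly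
syndetic. -/
theorem isThicklySyndetic_hitTimes [CompactSpace X] (hT : Continuous T) {O : Set X}
    (hO : IsOpen O) (h : ∀ z, IsMinimalPoint T z → z ∈ O) (x : X) :
    IsThicklySyndetic (hitTimes T x O) := by
  intro L
  have hopen : IsOpen (⋂ i ∈ Iio L, T^[i] ⁻¹' O) :=
    (finite_Iio L).isOpen_biInter fun i _ => hO.preimage (hT.iterate i)
  -- Each orbit closure contains a minimal point, whose whole orbit is minimal and so stays in `O`;
  -- every orbit thus reaches the open set of points staying in `O` for `L` steps.
  obtain ⟨g, hg⟩ := exists_bound_of_iUnion_eq_univ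
    (G := fun m => T^[m] ⁻¹' ⋂ i ∈ Iio L, T^[i] ⁻¹' O)
    (fun m => hopen.preimage (hT.iterate m)) (by
      intro w
      obtain ⟨z, hz, hzm⟩ := exists_isMinimalPoint hT w
      exact exists_iterate_mem_of_mem_closure_orb hz hopen (mem_iInter₂.2 fun i _ =>
        h _ (hzm.of_mem_closure_orb (subset_closure (iterate_mem_orb T z i)))))
  refine ⟨g, fun n => ?_⟩
  obtain ⟨m, hm, hx⟩ := hg (T^[n] x)
  refine ⟨n + m, by omega, by omega, fun i hi => ?_⟩
  have := mem_iInter₂.1 hx i hi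
  change T^[i] (T^[m] (T^[n] x)) ∈ O at this
  rwa [← Function.iterate_add_apply, ← Function.iterate_add_apply,
    show i + m + n = n + m + i by omega] at this

end Orbits

/-! ### Consequences of disjointness from all minimal systems. -/

section Disjointness

variable {X : Type u} [TopologicalSpace X] {T : X → X}

/-- The orbit closure of a pair of points with dense orbits is a joining. -/
theorem isJoining_closure_orb {Y : Type v} [TopologicalSpace Y] {S : Y → Y} [CompactSpace X]
    [T2Space X] [CompactSpace Y] [T2Space Y] (hT : Continuous T) (hS : Continuous S) {x : X}
    {y : Y} (hx : Dense (orb T x)) (hy : Dense (orb S y)) :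
    IsJoining T S (closure (orb (Prod.map T S) (x, y))) := by
  have hit : ∀ n, (T^[n] x, S^[n] y) ∈ closure (orb (Prod.map T S) (x, y)) := fun n =>
    subset_closure ⟨n, by simp [Prod.map_iterate]⟩
  refine ⟨⟨_, hit 0⟩, isClosed_closure, mapsTo_closure_orb (hT.prodMap hS) _, ?_, ?_⟩
  · rw [← (isClosed_closure.isCompact.image continuous_fst).isClosed.closure_eq]
    refine (hx.mono ?_).closure_eq
    rintro _ ⟨n, rfl⟩
    exact ⟨_, hit n, rfl⟩
  · rw [← (isClosed_closure.isCompact.image continuous_snd).isClosed.closure_eq]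
    refine (hy.mono ?_).closure_eq
    rintro _ ⟨n, rfl⟩
    exact ⟨_, hit n, rfl⟩

theorem AreDisjoint.exists_iterate_mem {Y : Type v} [TopologicalSpace Y] {S : Y → Y}
    [CompactSpace X] [T2Space X] [CompactSpace Y] [T2Space Y] (hd : AreDisjoint T S)
    (hT : Continuous T) (hS : Continuous S) {x : X} {y : Y} (hx : Dense (orb T x))
    (hy : Dense (orb S y)) {U : Set X} {V : Set Y} (hU : IsOpen U) (hUne : U.Nonempty)
    (hV : IsOpen V) (hVne : V.Nonempty) : ∃ n, T^[n] x ∈ U ∧ S^[n] y ∈ V := by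
  obtain ⟨a, ha⟩ := hUne
  obtain ⟨b, hb⟩ := hVne
  have hab : (a, b) ∈ closure (orb (Prod.map T S) (x, y)) := by
    rw [hd _ (isJoining_closure_orb hT hS hx hy)]
    trivial
  obtain ⟨n, hn⟩ := exists_iterate_mem_of_mem_closure_orb hab (hU.prod hV) ⟨ha, hb⟩
  rw [Prod.map_iterate] at hn
  exact ⟨n, hn⟩

/-- Disjointness is applied to the orbit closure of `z`. Only metrizability of `Z` is asked, so that
the sequence space qualifies without a chosen metric. -/
theorem DisjointFromMinimal.exists_iterate_mem [CompactSpace X] [T2Space X]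
    (h : DisjointFromMinimal T) (hT : Continuous T) {Z : Type u} [TopologicalSpace Z]
    [CompactSpace Z] [TopologicalSpace.MetrizableSpace Z] {S : Z → Z} (hS : Continuous S)
    {x : X} (hx : Dense (orb T x)) {z : Z} (hz : IsMinimalPoint S z) {U : Set X} {V : Set Z}
    (hU : IsOpen U) (hUne : U.Nonempty) (hV : IsOpen V) (hVne : ∃ n, S^[n] z ∈ V) :
    ∃ n, T^[n] x ∈ U ∧ S^[n] z ∈ V := by
  let : MetricSpace Z := TopologicalSpace.metrizableSpaceMetric Z
  have hM := hz.isMinimalSystem hS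
  have : CompactSpace (closure (orb S z)) :=
    isCompact_iff_compactSpace.1 isClosed_closure.isCompact
  have hc : Continuous ((mapsTo_closure_orb hS z).restrict S _ _) :=
    hS.restrict (mapsTo_closure_orb hS z)
  obtain ⟨m, hm⟩ := hVne
  obtain ⟨n, hn, hn'⟩ := (h _ _ ⟨hc, hM.surjective hc⟩ hM).exists_iterate_mem hT hc hx
    (hM.2 ⟨z, self_mem_closure_orb S z⟩) hU hUne (hV.preimage continuous_subtype_val)
    ⟨⟨S^[m] z, subset_closure (iterate_mem_orb S z m)⟩, hm⟩
  refine ⟨n, hn, ?_⟩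
  rwa [mem_preimage, MapsTo.coe_iterate_restrict] at hn'

/-- The shift on sequences of two symbols. -/
def shift (y : ℕ → ULift.{u} Bool) : ℕ → ULift.{u} Bool :=
  fun n => y (n + 1)

theorem continuous_shift : Continuous shift.{u} :=
  continuous_pi fun n => continuous_apply (n + 1)

theorem shift_iterate_apply (y : ℕ → ULift.{u} Bool) (m n : ℕ) : shift^[m] y n = y (m + n) := by
  induction m generalizing n with
  | zero => simp
  | succ m ih =>
    rw [Function.iterate_succ_apply']
    change shift^[m] y (n + 1) = _
    rw [ih]
    congr 1
    omega

theorem isMinimalPoint_shift {y : ℕ → ULift.{u} Bool}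
    (hy : ∀ N, IsSyndetic {j | ∀ i < N, y (j + i) = y i}) : IsMinimalPoint shift y := by
  refine isMinimalPoint_of_isSyndetic continuous_shift fun V hV => ?_
  rw [nhds_pi, Filter.mem_pi] at hV
  obtain ⟨I, hI, t, ht, hsub⟩ := hV
  obtain ⟨N, hN⟩ := hI.bddAbove
  obtain ⟨g, hg⟩ := hy (N + 1)
  refine ⟨g, fun i => (hg i).mono (inter_subset_inter_right _ fun j hj => hsub fun n hn => ?_)⟩
  rw [shift_iterate_apply, hj n (Nat.lt_succ_of_le (hN hn))]
  exact mem_of_mem_nhds (ht n)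

/-- A transitive system that is disjoint from all minimal systems has dense minimal points. -/
theorem DisjointFromMinimal.exists_isMinimalPoint_mem [CompactSpace X] [T2Space X]
    [SecondCountableTopology X] (h : DisjointFromMinimal T) (hT : Continuous T)
    (htrans : IsTransitive T) {U : Set X} (hU : IsOpen U) (hUne : U.Nonempty) :
    ∃ z ∈ U, IsMinimalPoint T z := by
  by_contra! hno
  obtain ⟨a, ha⟩ := hUne
  obtain ⟨F, hF, hFc, hFU⟩ := exists_mem_nhds_isClosed_subset (hU.mem_nhds ha)
  obtain ⟨x, -, hx⟩ := (htrans.dense_setOf_dense_orb hT).inter_open_nonempty univ isOpen_univ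
    ⟨a, trivial⟩
  obtain ⟨y, hyC, ⟨n₀, hn₀⟩, hy⟩ := (isThicklySyndetic_hitTimes hT hFc.isOpen_compl
    (fun z hz hzF => hno z (hFU hzF) hz) x).exists_uniformlyRecurrent
  -- `ULift` puts the shift in the universe over which `DisjointFromMinimal` quantifies.
  have hV : IsOpen {z : ℕ → ULift.{u} Bool | z 0 = ULift.up true} :=
    (isOpen_discrete {ULift.up true}).preimage (continuous_apply (A := fun _ => ULift.{u} Bool) 0)
  obtain ⟨n, hn, hn'⟩ := h.exists_iterate_mem hT continuous_shift.{u} hx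
    (z := fun n => ULift.up (y n)) (isMinimalPoint_shift (by simpa using hy))
    (V := {z | z 0 = ULift.up true}) isOpen_interior ⟨a, mem_interior_iff_mem_nhds.2 hF⟩ hV
    ⟨n₀, by rw [mem_ofPred_eq, shift_iterate_apply]; simpa using hn₀⟩
  rw [mem_ofPred_eq, shift_iterate_apply] at hn'
  exact hyC n (by simpa using hn') (interior_subset hn)

/-- A transitive system that is disjoint from all minimal systems is weakly mixing. -/
theorem DisjointFromMinimal.isWeaklyMixing [CompactSpace X] [TopologicalSpace.MetrizableSpace X]
    [SecondCountableTopology X] (h : DisjointFromMinimal T) (hT : IsTDS T)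
    (htrans : IsTransitive T) : IsWeaklyMixing T := by
  rintro A B hA ⟨⟨a₁, a₂⟩, ha⟩ hB ⟨⟨b₁, b₂⟩, hb⟩
  obtain ⟨U₁, U₂, hU₁, hU₂, ha₁, ha₂, hUA⟩ := isOpen_prod_iff.1 hA a₁ a₂ ha
  obtain ⟨V₁, V₂, hV₁, hV₂, hb₁, hb₂, hVB⟩ := isOpen_prod_iff.1 hB b₁ b₂ hb
  refine infinite_of_not_bddAbove ?_
  rintro ⟨N, hN⟩
  obtain ⟨k, ⟨c, hc, hc'⟩, hk⟩ := (htrans U₂ V₂ hU₂ ⟨a₂, ha₂⟩ hV₂ ⟨b₂, hb₂⟩).exists_gt N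
  have hW : IsOpen (U₂ ∩ T^[k] ⁻¹' V₂) := hU₂.inter (hV₂.preimage (hT.continuous.iterate k))
  obtain ⟨z, hzW, hz⟩ := h.exists_isMinimalPoint_mem hT.continuous htrans hW ⟨c, hc, hc'⟩
  obtain ⟨x, hxU, hx⟩ := (htrans.dense_setOf_dense_orb hT.continuous).inter_open_nonempty U₁ hU₁
    ⟨a₁, ha₁⟩
  obtain ⟨d, hd⟩ := hT.surjective.iterate k b₁
  -- With `T^n z ∈ W` and `T^n x ∈ T^(-k) V₁`, the pair `(x, z)` goes from `U₁ × U₂` to `V₁ × V₂` at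
  -- time `k + n > N`.
  obtain ⟨n, hn, -, hn'⟩ := h.exists_iterate_mem hT.continuous hT.continuous hx hz
    (hV₁.preimage (hT.continuous.iterate k)) ⟨d, by rwa [mem_preimage, hd]⟩ hW ⟨0, hzW⟩
  have hmem : k + n ∈ meetTimes (Prod.map T T) A B := by
    refine ⟨(x, z), hUA ⟨hxU, hzW.1⟩, ?_⟩
    rw [mem_preimage, Prod.map_iterate]
    refine hVB ⟨?_, ?_⟩
    · simpa [Function.iterate_add_apply] using hn
    · simpa [Function.iterate_add_apply] using hn'
  have := hN hmem
  omega

theorem DisjointFromMinimal.exists_isMinimalPoint_isSyndetic [CompactSpace X] [T2Space X]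
    [SecondCountableTopology X] (h : DisjointFromMinimal T) (hT : Continuous T)
    (htrans : IsTransitive T) {Y : Type u} [MetricSpace Y] [CompactSpace Y] {S : Y → Y}
    (hS : IsTDS S) (hmin : IsMinimalSystem S) {U : Set X} {V : Set Y} (hU : IsOpen U)
    (hUne : U.Nonempty) (hV : IsOpen V) (hVne : V.Nonempty) :
    ∃ x ∈ U, IsMinimalPoint T x ∧
      ∀ y, IsSyndetic (hitTimes (Prod.map T S) (x, y) (U ×ˢ V)) := by
  obtain ⟨x₀, hx₀U, hx₀⟩ := (htrans.dense_setOf_dense_orb hT).inter_open_nonempty U hU hUne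
  obtain ⟨K, hK⟩ := exists_bound_of_iUnion_eq_univ
    (G := fun n => {y | T^[n] x₀ ∈ U ∧ S^[n] y ∈ V})
    (fun n => isOpen_const.inter (hV.preimage (hS.continuous.iterate n)))
    (fun y => (h Y S hS hmin).exists_iterate_mem hT hS.continuous hx₀ (hmin.2 y) hU hUne hV hVne)
  -- Points of the neighbourhood below repeat all visits of `x₀` to `U` up to time `K`. At each
  -- return `m` of `x` to it, the bound `K` applied to `S^m y` yields a joint visit.
  set R : Set ℕ := {n | n ≤ K ∧ T^[n] x₀ ∈ U} with hR
  have hW : IsOpen (U ∩ ⋂ n ∈ R, T^[n] ⁻¹' U) :=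
    hU.inter (((finite_Iic K).subset fun n hn => hn.1).isOpen_biInter
      fun n _ => hU.preimage (hT.iterate n))
  obtain ⟨x, hxW, hx⟩ := h.exists_isMinimalPoint_mem hT htrans hW
    ⟨x₀, hx₀U, mem_iInter₂.2 fun n hn => hn.2⟩
  refine ⟨x, hxW.1, hx, fun y => ?_⟩
  obtain ⟨N, hN⟩ := hx.isSyndetic_hitTimes hT hW hxW
  refine ⟨N + K, fun i => ?_⟩
  obtain ⟨m, ⟨hm1, hm2⟩, -, hm⟩ := hN i
  obtain ⟨r, hr, hrU, hrV⟩ := hK (S^[m] y)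
  have hrx := mem_iInter₂.1 hm r ⟨hr, hrU⟩
  refine ⟨r + m, ⟨by omega, by omega⟩, ?_⟩
  rw [hitTimes, mem_ofPred_eq, Prod.map_iterate]
  refine ⟨?_, ?_⟩
  · simpa [Function.iterate_add_apply] using hrx
  · simpa [Function.iterate_add_apply] using hrV

end Disjointness

/-! ### Weak mixing, proximality and the converse. -/

section WeakMixing

variable {X : Type u} {T : X → X}

/-- Weak mixing gives one `n` for which `U₁ ∩ T^(-n) U₂` and `V₁ ∩ T^(-n) V₂` are both nonempty. An
orbit from the first to the second also carries `U₂` to `V₂`, since iterates commute. -/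
theorem IsWeaklyMixing.exists_meetTimes_subset_inter [TopologicalSpace X] (hT : Continuous T)
    (hw : IsWeaklyMixing T) {U₁ V₁ U₂ V₂ : Set X} (hU₁ : IsOpen U₁) (hU₁n : U₁.Nonempty)
    (hV₁ : IsOpen V₁) (hV₁n : V₁.Nonempty) (hU₂ : IsOpen U₂) (hU₂n : U₂.Nonempty)
    (hV₂ : IsOpen V₂) (hV₂n : V₂.Nonempty) :
    ∃ U V, IsOpen U ∧ U.Nonempty ∧ IsOpen V ∧ V.Nonempty ∧
      meetTimes T U V ⊆ meetTimes T U₁ V₁ ∩ meetTimes T U₂ V₂ := by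
  obtain ⟨n, ⟨a, b⟩, ⟨ha, hb⟩, hab⟩ := (hw _ _ (hU₁.prod hV₁) (hU₁n.prod hV₁n) (hU₂.prod hV₂)
    (hU₂n.prod hV₂n)).nonempty
  rw [mem_preimage, Prod.map_iterate] at hab
  refine ⟨U₁ ∩ T^[n] ⁻¹' U₂, V₁ ∩ T^[n] ⁻¹' V₂, hU₁.inter (hU₂.preimage (hT.iterate n)),
    ⟨a, ha, hab.1⟩, hV₁.inter (hV₂.preimage (hT.iterate n)), ⟨b, hb, hab.2⟩, ?_⟩
  rintro m ⟨x, ⟨hx1, hx2⟩, hx3, hx4⟩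
  refine ⟨⟨x, hx1, hx3⟩, T^[n] x, hx2, ?_⟩
  rw [mem_preimage, ← Function.iterate_add_apply] at hx4 ⊢
  rwa [add_comm]

/-- Furstenberg's intersection lemma. -/
theorem IsWeaklyMixing.exists_forall_mem_meetTimes [TopologicalSpace X] (hT : Continuous T)
    (hw : IsWeaklyMixing T) {ι : Type v} {O : Set X} (hO : IsOpen O) (hOn : O.Nonempty)
    {W : ι → Set X} (hW : ∀ i, IsOpen (W i)) (hWn : ∀ i, (W i).Nonempty) (t : Finset ι) :
    ∃ n, ∀ i ∈ t, n ∈ meetTimes T O (W i) := by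
  classical
  obtain ⟨U, V, hU, hUn, hV, hVn, h⟩ : ∃ U V, IsOpen U ∧ U.Nonempty ∧ IsOpen V ∧ V.Nonempty ∧
      ∀ n ∈ meetTimes T U V, ∀ i ∈ t, n ∈ meetTimes T O (W i) := by
    induction t using Finset.induction_on with
    | empty => exact ⟨O, O, hO, hOn, hO, hOn, by simp⟩
    | insert j t _ ih =>
      obtain ⟨U, V, hU, hUn, hV, hVn, h⟩ := ih
      obtain ⟨U', V', hU', hUn', hV', hVn', h'⟩ :=
        hw.exists_meetTimes_subset_inter hT hU hUn hV hVn hO hOn (hW j) (hWn j)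
      refine ⟨U', V', hU', hUn', hV', hVn', fun n hn i hi => ?_⟩
      rcases Finset.mem_insert.1 hi with rfl | hi
      · exact (h' hn).2
      · exact h n (h' hn).1 i hi
  obtain ⟨n, ⟨a, b⟩, ⟨ha, -⟩, hab⟩ := (hw _ _ (hU.prod hU) (hUn.prod hUn) (hV.prod hV)
    (hVn.prod hVn)).nonempty
  rw [mem_preimage, Prod.map_iterate] at hab
  exact ⟨n, h n ⟨a, ha, hab.1⟩⟩

/-- In a weakly mixing system every proximal cell is dense. -/
theorem IsWeaklyMixing.dense_proximal [MetricSpace X] [CompactSpace X] (hT : Continuous T)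
    (hw : IsWeaklyMixing T) (x : X) :
    Dense {u | ∀ ε > 0, ∃ m, dist (T^[m] x) (T^[m] u) < ε} := by
  have hd : Dense (⋂ k : ℕ, ⋃ m : ℕ, {u | dist (T^[m] x) (T^[m] u) < 1 / ((k : ℝ) + 1)}) := by
    refine dense_iInter_of_isOpen_nat (fun k => isOpen_iUnion fun m =>
      isOpen_lt (continuous_const.dist (hT.iterate m)) continuous_const) fun k => ?_
    refine dense_iff_inter_open.2 fun O hO hOn => ?_
    have hε : (0 : ℝ) < 1 / ((k : ℝ) + 1) / 2 := by positivity
    obtain ⟨t, ht⟩ := (isCompact_univ (X := X)).elim_nhds_subcover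
      (fun c => Metric.ball c (1 / ((k : ℝ) + 1) / 2)) fun c _ => Metric.ball_mem_nhds c hε
    -- At a single time `m` the image of `O` meets every ball of the cover, including the one
    -- containing `T^m x`.
    obtain ⟨m, hm⟩ := hw.exists_forall_mem_meetTimes hT hO hOn
      (W := fun c => Metric.ball c (1 / ((k : ℝ) + 1) / 2)) (fun c => Metric.isOpen_ball)
      (fun c => ⟨c, Metric.mem_ball_self hε⟩) t
    obtain ⟨c, hct, hc⟩ := mem_iUnion₂.1 (ht.2 (mem_univ (T^[m] x)))
    obtain ⟨u, huO, hu⟩ := hm c hct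
    refine ⟨u, huO, mem_iUnion.2 ⟨m, ?_⟩⟩
    have h1 := dist_triangle_right (T^[m] x) (T^[m] u) c
    rw [Metric.mem_ball] at hc
    rw [mem_preimage, Metric.mem_ball] at hu
    rw [mem_ofPred_eq]
    linarith
  refine hd.mono fun u hu ε hε => ?_
  obtain ⟨k, hk⟩ := exists_nat_one_div_lt hε
  obtain ⟨m, hm⟩ := mem_iUnion.1 (mem_iInter.1 hu k)
  exact ⟨m, lt_trans hm hk⟩

/-- Along the orbit of `(T^i x, S^i y)`, the target is always at most `N` steps away. A pair of `J`
with the same second coordinate and a proximal first one comes arbitrarily close to that orbit, so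
by compactness `J` cannot miss the target. -/
theorem exists_mem_joining_closure [MetricSpace X] [CompactSpace X] (hT : Continuous T)
    (hw : IsWeaklyMixing T) {Y : Type v} [MetricSpace Y] [CompactSpace Y] {S : Y → Y}
    (hS : IsTDS S) (hmin : IsMinimalSystem S) {J : Set (X × Y)} (hJ : IsJoining T S J)
    {U : Set X} {V : Set Y} (hV : IsOpen V) (hVn : V.Nonempty) {x : X}
    (hx : ∀ y ∈ V, IsSyndetic (hitTimes (Prod.map T S) (x, y) (U ×ˢ V))) :
    (J ∩ closure U ×ˢ closure V).Nonempty := by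
  obtain ⟨v, hv⟩ := hVn
  obtain ⟨F, hF, hFc, hFV⟩ := exists_mem_nhds_isClosed_subset (hV.mem_nhds hv)
  obtain ⟨K, hK⟩ := exists_bound_of_iUnion_eq_univ (G := fun n => S^[n] ⁻¹' interior F)
    (fun n => isOpen_interior.preimage (hS.continuous.iterate n))
    (fun y => hmin.exists_iterate_mem isOpen_interior ⟨v, mem_interior_iff_mem_nhds.2 hF⟩ y)
  -- Each `y = S^K y'` has `S^n y' ∈ F` for some `n ≤ K`, so `y` lies in `S^(K-n) F`.
  have hcov : ∀ y, ∃ i, ∃ y' ∈ F, S^[i] y' = y := by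
    intro y
    obtain ⟨y', rfl⟩ := hS.surjective.iterate K y
    obtain ⟨n, hn, hy'⟩ := hK y'
    refine ⟨K - n, S^[n] y', interior_subset hy', ?_⟩
    rw [← Function.iterate_add_apply, Nat.sub_add_cancel hn]
  let A : ℕ → Set X := fun i => {u | ∃ y ∈ F, (u, S^[i] y) ∈ J}
  have hAc : ∀ i, IsClosed (A i) := by
    intro i
    have h1 : IsClosed {p : X × Y | p.2 ∈ F ∧ (p.1, S^[i] p.2) ∈ J} :=
      (hFc.preimage continuous_snd).inter (hJ.isClosed.preimage
        (continuous_fst.prodMk ((hS.continuous.iterate i).comp continuous_snd)))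
    convert (h1.isCompact.image continuous_fst).isClosed using 1
    ext u
    constructor
    · rintro ⟨y, hy, h⟩
      exact ⟨(u, y), ⟨hy, h⟩, rfl⟩
    · rintro ⟨⟨u, y⟩, ⟨hy, h⟩, rfl⟩
      exact ⟨y, hy, h⟩
  have hAU : ⋃ i, A i = univ := by
    refine eq_univ_of_forall fun u => ?_
    have hu : u ∈ Prod.fst '' J := hJ.image_fst ▸ mem_univ u
    obtain ⟨⟨u, y⟩, h, rfl⟩ := hu
    obtain ⟨i, y', hy', rfl⟩ := hcov y
    exact mem_iUnion.2 ⟨i, y', hy', h⟩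
  have : Nonempty X := ⟨x⟩
  obtain ⟨i, hi⟩ := nonempty_interior_of_iUnion_of_closed hAc hAU
  obtain ⟨u, hui, hu⟩ := (hw.dense_proximal hT (T^[i] x)).inter_open_nonempty _ isOpen_interior hi
  obtain ⟨y, hyF, hyJ⟩ := interior_subset hui
  obtain ⟨N, hN⟩ := hx y (hFV hyF)
  by_contra hempty
  let D : Set (X × Y) := ⋃ j ∈ Iic N, (Prod.map T S)^[j] ⁻¹' (closure U ×ˢ closure V)
  have hDc : IsClosed D := (finite_Iic N).isClosed_biUnion fun j _ =>
    (isClosed_closure.prod isClosed_closure).preimage ((hT.prodMap hS.continuous).iterate j)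
  have hdisj : Disjoint J D := by
    refine disjoint_left.2 fun p hp hpD => ?_
    obtain ⟨j, -, hj⟩ := mem_iUnion₂.1 hpD
    exact hempty ⟨_, hJ.invariant.iterate j hp, hj⟩
  obtain ⟨δ, hδ, hthick⟩ := hdisj.exists_thickenings hJ.isClosed.isCompact hDc
  obtain ⟨m, hm⟩ := hu δ hδ
  have hq : (T^[m] u, S^[m] (S^[i] y)) ∈ J := by
    have := hJ.invariant.iterate m hyJ
    rwa [Prod.map_iterate] at this
  have hp : (T^[m] (T^[i] x), S^[m] (S^[i] y)) ∈ D := by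
    obtain ⟨n, ⟨hn1, hn2⟩, hn⟩ := hN (m + i)
    refine mem_iUnion₂.2 ⟨n - (m + i), by rw [mem_Iic]; omega, ?_⟩
    rw [hitTimes, mem_ofPred_eq, Prod.map_iterate] at hn
    rw [mem_preimage, Prod.map_iterate, Prod.map_apply, ← Function.iterate_add_apply,
      ← Function.iterate_add_apply, ← Function.iterate_add_apply, ← Function.iterate_add_apply,
      show n - (m + i) + m + i = n by omega]
    exact ⟨subset_closure hn.1, subset_closure hn.2⟩
  refine disjoint_left.1 hthick (Metric.mem_thickening_iff.2 ⟨_, hq, ?_⟩)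
    (Metric.self_subset_thickening hδ _ hp)
  rw [Prod.dist_eq, dist_self]
  exact max_lt hm hδ

/-- A point off `J` has a product neighbourhood off `J`; shrinking its factors to closed
neighbourhoods leaves room for the closures in `exists_mem_joining_closure`. -/
theorem areDisjoint_of_isSyndetic [MetricSpace X] [CompactSpace X] (hT : Continuous T)
    (hw : IsWeaklyMixing T) {Y : Type v} [MetricSpace Y] [CompactSpace Y] {S : Y → Y}
    (hS : IsTDS S) (hmin : IsMinimalSystem S)
    (h : ∀ (U : Set X) (V : Set Y), IsOpen U → U.Nonempty → IsOpen V → V.Nonempty →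
      ∃ x ∈ U, ∀ y ∈ V, IsSyndetic (hitTimes (Prod.map T S) (x, y) (U ×ˢ V))) :
    AreDisjoint T S := by
  intro J hJ
  by_contra hne
  obtain ⟨⟨a, b⟩, hab⟩ := (ne_univ_iff_exists_notMem J).1 hne
  obtain ⟨U, V, hU, hV, ha, hb, hUV⟩ := isOpen_prod_iff.1 hJ.isClosed.isOpen_compl a b hab
  obtain ⟨F, hF, hFc, hFU⟩ := exists_mem_nhds_isClosed_subset (hU.mem_nhds ha)
  obtain ⟨G, hG, hGc, hGV⟩ := exists_mem_nhds_isClosed_subset (hV.mem_nhds hb)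
  have hGn : (interior G).Nonempty := ⟨b, mem_interior_iff_mem_nhds.2 hG⟩
  obtain ⟨x, -, hx⟩ := h _ _ isOpen_interior ⟨a, mem_interior_iff_mem_nhds.2 hF⟩
    isOpen_interior hGn
  obtain ⟨p, hpJ, hp1, hp2⟩ :=
    exists_mem_joining_closure hT hw hS hmin hJ isOpen_interior hGn hx
  exact hUV ⟨hFU (closure_minimal interior_subset hFc hp1),
    hGV (closure_minimal interior_subset hGc hp2)⟩ hpJ

end WeakMixing

end TopDyn

theorem theorem3p2 {X : Type u} [MetricSpace X] [CompactSpace X] (T : X → X)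
    (hT : TopDyn.IsTDS T) (htrans : TopDyn.IsTransitive T) :
    List.TFAE [
      TopDyn.DisjointFromMinimal T,
      TopDyn.IsWeaklyMixing T ∧
        ∀ (Y : Type u) [MetricSpace Y] [CompactSpace Y] (S : Y → Y),
          TopDyn.IsTDS S → TopDyn.IsMinimalSystem S →
          ∀ (U : Set X) (V : Set Y), IsOpen U → U.Nonempty → IsOpen V → V.Nonempty →
            ∃ x ∈ U, ∀ y ∈ V,
              TopDyn.IsSyndetic (TopDyn.hitTimes (Prod.map T S) (x, y) (U ×ˢ V)),
      TopDyn.IsWeaklyMixing T ∧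
        ∀ (Y : Type u) [MetricSpace Y] [CompactSpace Y] (S : Y → Y),
          TopDyn.IsTDS S → TopDyn.IsMinimalSystem S →
          ∀ (U : Set X) (V : Set Y), IsOpen U → U.Nonempty → IsOpen V → V.Nonempty →
            ∃ x ∈ U, TopDyn.IsMinimalPoint T x ∧ ∀ y ∈ V,
              TopDyn.IsSyndetic (TopDyn.hitTimes (Prod.map T S) (x, y) (U ×ˢ V))] := by

  tfae_have 1 → 3 := fun h =>
    ⟨h.isWeaklyMixing hT htrans, fun Y _ _ S hS hmin U V hU hUn hV hVn => by
      obtain ⟨x, hxU, hx, hsyn⟩ :=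
        h.exists_isMinimalPoint_isSyndetic hT.continuous htrans hS hmin hU hUn hV hVn
      exact ⟨x, hxU, hx, fun y _ => hsyn y⟩⟩
  tfae_have 3 → 2 := fun h =>
    ⟨h.1, fun Y _ _ S hS hmin U V hU hUn hV hVn => by
      obtain ⟨x, hxU, -, hsyn⟩ := h.2 Y S hS hmin U V hU hUn hV hVn
      exact ⟨x, hxU, hsyn⟩⟩
  tfae_have 2 → 1 := fun h Y _ _ S hS hmin =>
    TopDyn.areDisjoint_of_isSyndetic hT.continuous h.1 hS hmin (h.2 Y S hS hmin)
  tfae_finish
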